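/- Let $F$ be a finite field of characteristic $2$ with $F\neq\mathbb F_2$, and let $R$ be a complete local $W(F)$-algebra that is a filtered inverse limit of local Artin $W(F)$-algebras with residue field $F$, with its inverse limit topology. Here $W(F)$ is the ring of Witt vectors of $F$. Let $\mathfrak m_R$ be the maximal ideal of $R$, and suppose that $\dim_F \mathfrak m_R/\mathfrak m_R^2=1$. If $F\cong\mathbb F_4$, suppose in addition that $2\in\mathfrak m_R^2$. Then every closed subgroup $H\subset \mathrm{SL}_2(R)$ whose image under reduction is all of $\mathrm{SL}_2(R/(2,\mathfrak m_R^2))$ equals $\mathrm{SL}_2(R)$. -/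

import Mathlib

open scoped Matrix

/-- Let `F` be a field of characteristic `p` and `R` a local ring with a `W(F)`-algebra structure
and a uniform structure.  `IsProArtinLocal p F R` says that `R` is a complete local `W(F)`-algebra that is
a filtered inverse limit of local Artin `W(F)`-algebras with residue field `F`, with the
inverse limit topology of the discrete topologies: the structure map
`W(F) → R` induces a surjection of `W(F)` onto the residue field of `R` (its kernel is then the
maximal ideal of `W(F)`, so that the residue field is `F`), `R` is a complete
Hausdorff topological ring in which the open ideals are a basis of neighbourhoods of zero
(so that `R` is the inverse limit of the rings `R ⧸ I`, `I` an open ideal), and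
all these quotients are Artinian. -/
class IsProArtinLocal (p : ℕ) [Fact p.Prime] (F : Type*) [Field F] [CharP F p]
    (R : Type*) [CommRing R] [IsLocalRing R] [Algebra (WittVector p F) R] [UniformSpace R] :
    Prop where
  residue_surjective : Function.Surjective
    ((IsLocalRing.residue R).comp (algebraMap (WittVector p F) R))
  isUniformAddGroup : IsUniformAddGroup R
  isTopologicalRing : IsTopologicalRing R
  isLinearTopology : IsLinearTopology R R
  t2Space : T2Space R
  completeSpace : CompleteSpace R
  isArtinianRing_quotient : ∀ I : Ideal R, IsOpen (I : Set R) → IsArtinianRing (R ⧸ I)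

/-!
Write `k` for the residue field, `𝔪` for the maximal ideal, and `Γ n` for the principal congruence
subgroup of level `𝔪 ^ n`. As `H` is closed, it suffices that `H` surjects onto `SL₂` modulo every
power of `𝔪`. Let `x` generate `𝔪` modulo `𝔪 ^ 2`. In the induction step one has to see that
`H Γ (n + 1)` contains `Γ n`. The quotient `Γ n / Γ (n + 1)` consists of the elements `1 + x ^ n M`
with `M` a matrix of trace zero over `k`, and the part coming from `H` is additive and invariant
under conjugation by `SL₂(k)`. Since `k` is perfect of characteristic two and has an element other
than `0` and `1`, such a set contains all matrices of trace zero as soon as it contains a nonscalar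
one, so a single nonscalar element is needed in each step.

The elements of `Γ 1` can be adjusted to lie in `H`, without changing their commutators and squares
modulo a higher power of `𝔪`. If `2 ∈ 𝔪 ^ 2`, the commutator of `diag (1 + x, (1 + x)⁻¹)` with the
unipotent matrix of entry `x ^ (n - 2)` is nonscalar in `Γ n` for `n ≥ 3`; otherwise `x = 2`, and
the square of the unipotent matrix of entry `2 ^ (n - 1)` is nonscalar in `Γ n` for `n ≥ 2`. In the
one remaining layer, `n = 2` or `n = 1`, if all elements of `H` were scalar, then the determinant
condition would fail on suitable lifts to `H`; for `n = 1` these are the lifts of the unipotent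
matrices with entries `1`, `s` and `s + 1`, where `s ^ 2 + s + 1` is nonzero in `k`.
-/

namespace SL2Lift

open scoped MatrixGroups commutatorElement

section Group

variable {G : Type*} [Group G] {H M N : Subgroup G}

lemma exists_mem_inf_mul_eq [N.Normal] (hNM : N ≤ M) (h : H ⊔ N = ⊤) {u : G} (hu : u ∈ M) :
    ∃ a ∈ H ⊓ M, ∃ c ∈ N, a * c = u := by
  obtain ⟨a, ha, c, hc, rfl⟩ := Subgroup.mem_sup_of_normal_right.1 (h ▸ Subgroup.mem_top u)
  exact ⟨a, ⟨ha, (M.mul_mem_cancel_right (hNM hc)).1 hu⟩, c, hc, rfl⟩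

lemma commutator_self_le_of_sup_eq_top [N.Normal] (hNM : N ≤ M) (h : H ⊔ N = ⊤)
    (hMN : ⁅M, N⁆ ≤ H) : ⁅M, M⁆ ≤ H := by
  refine Subgroup.commutator_le.2 fun u hu v hv ↦ ?_
  obtain ⟨a, ha, c, hc, rfl⟩ := exists_mem_inf_mul_eq hNM h hu
  obtain ⟨b, hb, d, hd, rfl⟩ := exists_mem_inf_mul_eq hNM h hv
  have hcv : ⁅c, b * d⁆ ∈ H :=
    hMN (Subgroup.commutator_comm N M ▸ Subgroup.commutator_mem_commutator hc hv)
  have had : ⁅a, d⁆ ∈ H := hMN (Subgroup.commutator_mem_commutator ha.2 hd)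
  have hab : ⁅a, b⁆ ∈ H :=
    H.mul_mem (H.mul_mem (H.mul_mem ha.1 hb.1) (H.inv_mem ha.1)) (H.inv_mem hb.1)
  have hav : ⁅a, b * d⁆ ∈ H := by
    rw [commutatorElement_mul_right_eq_mul_conj]
    exact H.mul_mem (H.mul_mem (H.mul_mem hab hb.1) had) (H.inv_mem hb.1)
  rw [commutatorElement_mul_left_eq_conj_mul]
  exact H.mul_mem (H.mul_mem (H.mul_mem ha.1 hcv) (H.inv_mem ha.1)) hav

lemma sq_mem_of_sup_eq_top [N.Normal] (hNM : N ≤ M) (h : H ⊔ N = ⊤) (hMN : ⁅M, N⁆ ≤ H)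
    (hN : ∀ c ∈ N, c ^ 2 ∈ H) {u : G} (hu : u ∈ M) : u ^ 2 ∈ H := by
  obtain ⟨a, ha, c, hc, rfl⟩ := exists_mem_inf_mul_eq hNM h hu
  have hsq : (a * c) ^ 2 = a ^ 2 * ⁅a⁻¹, c⁆ * c ^ 2 := by
    simp [commutatorElement_def, sq, mul_assoc]
  rw [hsq]
  exact H.mul_mem (H.mul_mem (H.pow_mem ha.1 2)
    (hMN (Subgroup.commutator_mem_commutator (M.inv_mem ha.2) hc))) (hN c hc)

lemma normal_inf_of_sup_eq_top [N.Normal] [M.Normal] (h : H ⊔ N = ⊤) (hMN : ⁅M, N⁆ ≤ H) :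
    (H ⊓ M).Normal := by
  refine ⟨fun k hk g ↦ ⟨?_, ‹M.Normal›.conj_mem k hk.2 g⟩⟩
  obtain ⟨a, ha, c, hc, rfl⟩ := Subgroup.mem_sup_of_normal_right.1 (h ▸ Subgroup.mem_top g)
  have hck : ⁅c, k⁆ ∈ H :=
    hMN (Subgroup.commutator_comm N M ▸ Subgroup.commutator_mem_commutator hc hk.2)
  have hconj : a * c * k * (a * c)⁻¹ = a * (⁅c, k⁆ * k) * a⁻¹ := by
    simp [commutatorElement_def, mul_assoc]
  rw [hconj]
  exact H.mul_mem (H.mul_mem ha (H.mul_mem hck hk.1)) (H.inv_mem ha)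

end Group

section Congruence

variable {n R : Type*} [Fintype n] [DecidableEq n] [CommRing R] {I J : Ideal R}

lemma mul_mem_matrix_mul {M N : Matrix n n R} (hM : M ∈ I.matrix n) (hN : N ∈ J.matrix n) :
    M * N ∈ (I * J).matrix n := fun i j ↦ by
  rw [Matrix.mul_apply]
  exact sum_mem fun l _ ↦ Ideal.mul_mem_mul (hM i l) (hN l j)

instance : (J.matrix n).IsTwoSided where
  mul_mem_of_left N hM i j := by
    rw [Matrix.mul_apply]
    exact sum_mem fun l _ ↦ J.mul_mem_right _ (hM i l)

/-- The principal congruence subgroup of level `J`: the matrices of determinant one that reduce to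
the identity modulo `J`. -/
def principalCongruence (n : Type*) [Fintype n] [DecidableEq n] (J : Ideal R) :
    Subgroup (Matrix.SpecialLinearGroup n R) :=
  (Matrix.SpecialLinearGroup.map (Ideal.Quotient.mk J)).ker

instance : (principalCongruence n J).Normal := MonoidHom.normal_ker _

lemma mem_principalCongruence {g : Matrix.SpecialLinearGroup n R} :
    g ∈ principalCongruence n J ↔ (g : Matrix n n R) - 1 ∈ J.matrix n := by
  rw [principalCongruence, MonoidHom.mem_ker, Matrix.SpecialLinearGroup.ext_iff]
  refine forall₂_congr fun i j ↦ ?_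
  change Ideal.Quotient.mk J (g i j) = (1 : Matrix n n (R ⧸ J)) i j ↔ g i j - _ ∈ J
  rw [← Ideal.Quotient.eq, ← Matrix.map_one (Ideal.Quotient.mk J) (map_zero _) (map_one _),
    Matrix.map_apply]

lemma mem_principalCongruence_of_sub_smul_mem (hJ : J ≤ I) {c : R} (hc : c - 1 ∈ I)
    {g : Matrix.SpecialLinearGroup n R} (hg : g.1 - c • 1 ∈ J.matrix n) :
    g ∈ principalCongruence n I := by
  have hc1 : (c - 1) • (1 : Matrix n n R) ∈ I.matrix n := fun _ _ ↦ I.mul_mem_right _ hc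
  rw [mem_principalCongruence]
  convert add_mem (Ideal.matrix_monotone n hJ hg) hc1 using 1
  rw [sub_smul, one_smul, sub_add_sub_cancel]

lemma mul_mem_matrix_iff (a : Matrix.SpecialLinearGroup n R) {M : Matrix n n R} :
    a.1 * M ∈ J.matrix n ↔ M ∈ J.matrix n := by
  refine ⟨fun h ↦ ?_, Ideal.mul_mem_left _ _⟩
  have hM : (a⁻¹).1 * (a.1 * M) = M := by
    rw [← mul_assoc, ← Matrix.SpecialLinearGroup.coe_mul, inv_mul_cancel,
      Matrix.SpecialLinearGroup.coe_one, one_mul]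
  exact hM ▸ Ideal.mul_mem_left _ (a⁻¹).1 h

lemma inv_mul_mem_principalCongruence {a g : Matrix.SpecialLinearGroup n R} :
    a⁻¹ * g ∈ principalCongruence n J ↔ (g : Matrix n n R) - a ∈ J.matrix n := by
  rw [mem_principalCongruence, ← mul_mem_matrix_iff a, mul_sub, mul_one,
    ← Matrix.SpecialLinearGroup.coe_mul, mul_inv_cancel_left]

lemma principalCongruence_mono (h : I ≤ J) :
    principalCongruence n I ≤ principalCongruence n J := fun _ hg ↦
  mem_principalCongruence.2 (Ideal.matrix_monotone n h (mem_principalCongruence.1 hg))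

lemma commutator_mem_principalCongruence {g h : Matrix.SpecialLinearGroup n R} :
    ⁅g, h⁆ ∈ principalCongruence n J ↔ g.1 * h.1 - h.1 * g.1 ∈ J.matrix n := by
  rw [commutatorElement_def, mul_assoc, ← mul_inv_rev, Subgroup.Normal.mem_comm_iff inferInstance,
    inv_mul_mem_principalCongruence, Matrix.SpecialLinearGroup.coe_mul,
    Matrix.SpecialLinearGroup.coe_mul]

lemma commutator_principalCongruence_le :
    ⁅principalCongruence n I, principalCongruence n J⁆ ≤ principalCongruence n (I * J) := by
  refine Subgroup.commutator_le.2 fun g hg h hh ↦ ?_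
  rw [mem_principalCongruence] at hg hh
  have hgh : g.1 * h.1 - h.1 * g.1 = (g.1 - 1) * (h.1 - 1) - (h.1 - 1) * (g.1 - 1) := by
    noncomm_ring
  rw [commutator_mem_principalCongruence, hgh]
  exact sub_mem (mul_mem_matrix_mul hg hh) (mul_comm I J ▸ mul_mem_matrix_mul hh hg)

lemma commutator_principalCongruence_pow_le (m : ℕ) :
    ⁅principalCongruence n I, principalCongruence n (I ^ m)⁆ ≤
      principalCongruence n (I ^ (m + 1)) :=
  pow_succ' I m ▸ commutator_principalCongruence_le

lemma commutator_mem_principalCongruence_of_sub_smul_mem (g : Matrix.SpecialLinearGroup n R)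
    {h : Matrix.SpecialLinearGroup n R} {c : R} (hh : h.1 - c • 1 ∈ J.matrix n) :
    ⁅g, h⁆ ∈ principalCongruence n J := by
  have hgh : g.1 * h.1 - h.1 * g.1 = g.1 * (h.1 - c • 1) - (h.1 - c • 1) * g.1 := by
    rw [mul_sub, sub_mul, mul_smul_comm, smul_mul_assoc, mul_one, one_mul, sub_sub_sub_cancel_right]
  rw [commutator_mem_principalCongruence, hgh]
  exact sub_mem (Ideal.mul_mem_left _ _ hh) (Ideal.mul_mem_right _ _ hh)

lemma sq_mem_principalCongruence (h2 : (2 : R) ∈ I) (hJ : J ≤ I)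
    {g : Matrix.SpecialLinearGroup n R} (hg : g ∈ principalCongruence n J) :
    g ^ 2 ∈ principalCongruence n (I * J) := by
  rw [mem_principalCongruence] at hg ⊢
  have hsq : (g ^ 2).1 - 1 = (2 : R) • (g.1 - 1) + (g.1 - 1) * (g.1 - 1) := by
    rw [Matrix.SpecialLinearGroup.coe_pow, two_smul]
    noncomm_ring
  rw [hsq]
  exact add_mem (fun i j ↦ Ideal.mul_mem_mul h2 (hg i j))
    (mul_mem_matrix_mul (Ideal.matrix_monotone n hJ hg) hg)

lemma sup_principalCongruence_eq_top_of_map_eq_top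
    {H : Subgroup (Matrix.SpecialLinearGroup n R)}
    (h : H.map (Matrix.SpecialLinearGroup.map (Ideal.Quotient.mk J)) = ⊤) :
    H ⊔ principalCongruence n J = ⊤ := by
  rw [principalCongruence, ← Subgroup.comap_map_eq, h, Subgroup.comap_top]

lemma sup_principalCongruence_eq_top_mono {H : Subgroup (Matrix.SpecialLinearGroup n R)}
    (hIJ : I ≤ J) (h : H ⊔ principalCongruence n I = ⊤) : H ⊔ principalCongruence n J = ⊤ :=
  top_unique (h.ge.trans (sup_le_sup_left (principalCongruence_mono hIJ) H))

lemma exists_mem_sub_mem_matrix {H : Subgroup (Matrix.SpecialLinearGroup n R)}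
    (h : H ⊔ principalCongruence n J = ⊤) (g : Matrix.SpecialLinearGroup n R) :
    ∃ a ∈ H, (a : Matrix n n R) - g ∈ J.matrix n := by
  obtain ⟨a, ha, c, hc, rfl⟩ := Subgroup.mem_sup_of_normal_right.1 (h ▸ Subgroup.mem_top g)
  exact ⟨a, ha, inv_mul_mem_principalCongruence.1 (by simpa using hc)⟩

end Congruence

section Topology

open Topology

variable {n R : Type*} [Fintype n] [DecidableEq n] [CommRing R] [TopologicalSpace R]

lemma exists_principalCongruence_subset [IsTopologicalRing R] [IsLinearTopology R R]
    {U : Set (Matrix.SpecialLinearGroup n R)} (hU : U ∈ 𝓝 1) :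
    ∃ I : Ideal R, IsOpen (I : Set R) ∧ (principalCongruence n I : Set _) ⊆ U := by
  obtain ⟨V, hV, hVU⟩ := mem_nhds_induced _ _ _ |>.1 hU
  have hV0 : (1 + ·) ⁻¹' V ∈ 𝓝 (0 : Matrix n n R) :=
    (continuous_const.add continuous_id).continuousAt.preimage_mem_nhds (by simpa using! hV)
  have hbasis := ((IsLinearTopology.hasBasis_open_ideal (R := R)).pi_self (ι := n)).pi_self (ι := n)
  simp only [← nhds_pi] at hbasis
  obtain ⟨⟨s, t, I⟩, ⟨-, -, hI⟩, hIV⟩ := hbasis.mem_iff.1 hV0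
  refine ⟨I, hI, fun g hg ↦ hVU ?_⟩
  have hgV : g.1 - 1 ∈ (1 + ·) ⁻¹' V :=
    hIV fun i _ j _ ↦ mem_principalCongruence.1 hg i j
  simpa using! hgV

lemma eq_top_of_isClosed_of_forall_isOpen [IsTopologicalRing R] [IsLinearTopology R R]
    {H : Subgroup (Matrix.SpecialLinearGroup n R)}
    (hH : IsClosed (H : Set (Matrix.SpecialLinearGroup n R)))
    (h : ∀ I : Ideal R, IsOpen (I : Set R) → H ⊔ principalCongruence n I = ⊤) : H = ⊤ := by
  refine (Subgroup.eq_top_iff' H).2 fun g ↦ ?_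
  rw [← SetLike.mem_coe, ← hH.closure_eq, mem_closure_iff_nhds_one]
  intro U hU
  obtain ⟨I, hI, hIU⟩ := exists_principalCongruence_subset hU
  obtain ⟨c, hc, a, ha, hca⟩ := Subgroup.mem_sup_of_normal_left.1
    (sup_comm H _ ▸ h I hI ▸ Subgroup.mem_top g)
  refine ⟨a, ha, hIU ?_⟩
  simpa [← hca] using (principalCongruence n I).inv_mem hc

end Topology

section TwoByTwo

variable {R : Type*} [CommRing R] {J : Ideal R}

/-- The upper unitriangular matrix with off-diagonal entry `t`. -/
def upper (t : R) : SL(2, R) := ⟨!![1, t; 0, 1], by simp⟩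

/-- The diagonal matrix with entries `u` and `u⁻¹`. -/
def torus (u : Rˣ) : SL(2, R) := ⟨!![(u : R), 0; 0, (u⁻¹ : Rˣ)], by simp⟩

/-- The matrix that exchanges the two coordinates up to sign. -/
def weyl : SL(2, R) := ⟨!![0, 1; -1, 0], by simp⟩

lemma coe_upper (t : R) : (upper t).1 = !![1, t; 0, 1] := rfl

lemma coe_torus (u : Rˣ) : (torus u).1 = !![(u : R), 0; 0, (u⁻¹ : Rˣ)] := rfl

lemma coe_weyl : (weyl : SL(2, R)).1 = !![0, 1; -1, 0] := rfl

lemma coe_inv_fin_two (g : SL(2, R)) : (g⁻¹).1 = !![g 1 1, -g 0 1; -g 1 0, g 0 0] :=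
  Matrix.adjugate_fin_two g.1

lemma upper_mul (s t : R) : upper s * upper t = upper (s + t) := by
  ext i j
  fin_cases i <;> fin_cases j <;> simp [coe_upper, add_comm]

lemma upper_pow_two (t : R) : upper t ^ 2 = upper (2 * t) := by
  rw [sq, upper_mul, two_mul]

lemma commutator_torus_upper (u : Rˣ) (t : R) :
    ⁅torus u, upper t⁆ = upper (((u : R) ^ 2 - 1) * t) := by
  rw [commutatorElement_def, mul_inv_eq_iff_eq_mul, mul_inv_eq_iff_eq_mul, upper_mul]
  have hut : u * t = (((u : R) ^ 2 - 1) * t + t) * (u⁻¹ : Rˣ) := by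
    linear_combination (-(u : R) * t) * u.mul_inv
  ext i j
  fin_cases i <;> fin_cases j <;> simp [coe_upper, coe_torus, hut]

lemma upper_mem_principalCongruence {t : R} (ht : t ∈ J) :
    upper t ∈ principalCongruence (Fin 2) J := by
  rw [mem_principalCongruence, Ideal.mem_matrix]
  simp [Fin.forall_fin_two, coe_upper, ht]

lemma torus_mem_principalCongruence {u : Rˣ} (hu : (u : R) - 1 ∈ J) :
    torus u ∈ principalCongruence (Fin 2) J := by
  rw [mem_principalCongruence, Ideal.mem_matrix]
  have : ((u⁻¹ : Rˣ) : R) - 1 = - (u⁻¹ : Rˣ) * (u - 1) := by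
    linear_combination u.inv_mul
  simp [Fin.forall_fin_two, coe_torus, hu, this, J.mul_mem_left]

end TwoByTwo

section ConjugationInvariant

lemma exists_ne_zero_ne_one {k : Type*} [Semiring k] [Nontrivial k] (hk : Nat.card k ≠ 2) :
    ∃ s : k, s ≠ 0 ∧ s ≠ 1 := by
  contrapose! hk
  exact Nat.card_eq_two_iff.2 ⟨0, 1, zero_ne_one, Set.eq_univ_of_forall fun s ↦ by
    simpa using or_iff_not_imp_left.2 (hk s)⟩

lemma exists_sq_add_add_one_ne_zero {k : Type*} [Field k] [CharP k 2] (hk2 : Nat.card k ≠ 2)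
    (hk4 : Nat.card k ≠ 4) : ∃ s : k, s ≠ 0 ∧ s ≠ 1 ∧ s ^ 2 + s + 1 ≠ 0 := by
  classical
  obtain ⟨s, hs0, hs1⟩ := exists_ne_zero_ne_one hk2
  by_contra! h
  have huniv (t : k) : t ∈ ({0, 1, s, s + 1} : Finset k) := by
    have hroots (ht : t ^ 2 + t + 1 = 0) : t - s = 0 ∨ t + s + 1 = 0 := by
      rw [← mul_eq_zero]
      linear_combination ht - h s hs0 hs1
    have := h t
    simp only [Finset.mem_insert, Finset.mem_singleton]
    grind [CharTwo.add_self_eq_zero]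
  refine hk4 ?_
  rw [← Set.ncard_univ, ← Set.eq_univ_of_forall huniv, Set.ncard_coe_finset]
  have hs : s + 1 ≠ 0 := fun h ↦ hs1 (CharTwo.add_eq_zero.1 h)
  simp [hs0, hs0.symm, hs1.symm, hs.symm]

variable {k : Type*} [Field k] [CharP k 2] {W : AddSubmonoid (Matrix (Fin 2) (Fin 2) k)}

lemma eq_of_trace_eq_zero {B : Matrix (Fin 2) (Fin 2) k} (hB : B.trace = 0) :
    B = !![B 0 0, B 0 1; B 1 0, B 0 0] := by
  rw [Matrix.trace_fin_two, CharTwo.add_eq_zero] at hB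
  ext i j
  fin_cases i <;> fin_cases j <;> simp [hB]

lemma swap_mem (hW : ∀ g : SL(2, k), ∀ B ∈ W, g.1 * B * (g⁻¹).1 ∈ W) {a b c d : k}
    (h : !![a, b; c, d] ∈ W) : !![d, c; b, a] ∈ W := by
  simpa [coe_weyl, coe_inv_fin_two, CharTwo.neg_eq] using hW weyl _ h

lemma unipotent_add_mem (hW : ∀ g : SL(2, k), ∀ B ∈ W, g.1 * B * (g⁻¹).1 ∈ W) {a b c : k}
    (h : !![a, b; c, a] ∈ W) (t : k) : !![t * c, t ^ 2 * c; 0, t * c] ∈ W := by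
  convert W.add_mem (hW (upper t) _ h) h using 1
  ext i j
  fin_cases i <;> fin_cases j <;> simp [coe_upper] <;> grind

lemma scalar_mem (hW : ∀ g : SL(2, k), ∀ B ∈ W, g.1 * B * (g⁻¹).1 ∈ W)
    {s : k} (hs0 : s ≠ 0) (hs1 : s ≠ 1) {a b c : k} (hc : c ≠ 0) (h : !![a, b; c, a] ∈ W) (z : k) :
    !![z, 0; 0, z] ∈ W := by
  have hs : s + 1 ≠ 0 := fun h ↦ hs1 (CharTwo.add_eq_zero.1 h)
  set t := z / ((s + 1) * c) with ht
  have hz : z = t * c + s * t * c := by rw [ht]; field_simp; ring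
  have htorus := hW (torus (Units.mk0 s hs0)) _ (unipotent_add_mem hW h t)
  convert W.add_mem htorus (unipotent_add_mem hW h (s * t)) using 1
  ext i j
  fin_cases i <;> fin_cases j <;> simp [coe_torus] <;> grind

lemma upper_right_mem [PerfectRing k 2] (hW : ∀ g : SL(2, k), ∀ B ∈ W, g.1 * B * (g⁻¹).1 ∈ W)
    {s : k} (hs0 : s ≠ 0) (hs1 : s ≠ 1) {a b c : k} (hc : c ≠ 0) (h : !![a, b; c, a] ∈ W) (z : k) :
    !![0, z; 0, 0] ∈ W := by
  obtain ⟨t, ht⟩ := surjective_frobenius k 2 (z / c)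
  have hz : z = t ^ 2 * c := by rw [← frobenius_def, ht, div_mul_cancel₀ _ hc]
  convert W.add_mem (unipotent_add_mem hW h t) (scalar_mem hW hs0 hs1 hc h (t * c)) using 1
  ext i j
  fin_cases i <;> fin_cases j <;> simp [hz, CharTwo.add_self_eq_zero]

lemma mem_of_trace_eq_zero [PerfectRing k 2] (hk : Nat.card k ≠ 2)
    (hW : ∀ g : SL(2, k), ∀ B ∈ W, g.1 * B * (g⁻¹).1 ∈ W)
    {B C : Matrix (Fin 2) (Fin 2) k} (hB : B ∈ W) (htr : B.trace = 0)
    (hne : B 0 1 ≠ 0 ∨ B 1 0 ≠ 0) (hC : C.trace = 0) : C ∈ W := by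
  obtain ⟨s, hs0, hs1⟩ := exists_ne_zero_ne_one hk
  obtain ⟨a, b, c, hc, h⟩ : ∃ a b c, c ≠ 0 ∧ !![a, b; c, a] ∈ W := by
    rw [eq_of_trace_eq_zero htr] at hB
    exact hne.elim (fun h ↦ ⟨_, _, _, h, swap_mem hW hB⟩) fun h ↦ ⟨_, _, _, h, hB⟩
  have hright := upper_right_mem hW hs0 hs1 hc h
  rw [eq_of_trace_eq_zero hC]
  convert W.add_mem (W.add_mem (scalar_mem hW hs0 hs1 hc h (C 0 0)) (hright (C 0 1)))
    (swap_mem hW (hright (C 1 0))) using 1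
  simp

end ConjugationInvariant

section Layer

open IsLocalRing

variable {n R : Type*} [Fintype n] [DecidableEq n] [CommRing R] {J : Ideal R}

lemma specialLinearGroup_map_surjective {S : Type*} [CommRing S] {f : R →+* S} [IsLocalHom f]
    (hf : Function.Surjective f) :
    Function.Surjective (Matrix.SpecialLinearGroup.map (n := n) f) := by
  intro g
  cases isEmpty_or_nonempty n with
  | inl _ => exact ⟨1, Subsingleton.elim _ _⟩
  | inr hn =>
    obtain ⟨i⟩ := hn
    obtain ⟨M, hM⟩ : ∃ M : Matrix n n R, M.map f = g.1 :=
      ⟨g.1.map (Function.surjInv hf), by ext; simp [Function.surjInv_eq]⟩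
    have hdet : f M.det = 1 := by rw [RingHom.map_det, RingHom.mapMatrix_apply, hM, g.2]
    obtain ⟨u, hu⟩ := isUnit_of_map_unit f M.det (hdet ▸ isUnit_one)
    have hfu : f (u⁻¹ : Rˣ) = 1 := by simpa [hu, hdet] using congrArg f u.inv_mul
    refine ⟨⟨M.updateRow i ((u⁻¹ : Rˣ) • M i), ?_⟩, Subtype.ext ?_⟩
    · simp [Units.smul_def, Matrix.det_updateRow_smul, ← hu]
    · rw [← hM]
      ext a b
      change f (M.updateRow i _ a b) = f (M a b)
      rw [Matrix.updateRow_apply]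
      split_ifs with h <;> simp [h, hfu, Units.smul_def]

variable [IsLocalRing R] {y : R}

/-- The matrices `B` over the residue field for which `K` contains an element congruent to
`1 + y * M` modulo `J`, where `M` lifts `B`. They describe the subquotient `K Γ(J) / Γ(J)` of the
principal congruence subgroup of level `y R + J` additively. -/
def layer (K : Subgroup (Matrix.SpecialLinearGroup n R)) (hy : y * y ∈ J) :
    AddSubmonoid (Matrix n n (ResidueField R)) where
  carrier := {B | ∃ h ∈ K, ∃ M : Matrix n n R,
    M.map (residue R) = B ∧ h.1 - (1 + y • M) ∈ J.matrix n}
  zero_mem' := ⟨1, K.one_mem, 0, by simp, by simp⟩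
  add_mem' := by
    rintro _ _ ⟨g, hg, M, rfl, hgM⟩ ⟨h, hh, N, rfl, hhN⟩
    refine ⟨g * h, K.mul_mem hg hh, M + N, Matrix.map_add _ (map_add _) M N, ?_⟩
    have hgh : (g * h).1 - (1 + y • (M + N)) =
        (1 + y • M) * (h.1 - (1 + y • N)) + (g.1 - (1 + y • M)) * h.1 + (y • M) * (y • N) := by
      rw [Matrix.SpecialLinearGroup.coe_mul, smul_add]
      generalize y • M = M', y • N = N'
      noncomm_ring
    rw [hgh, smul_mul_smul_comm]
    exact add_mem (add_mem (Ideal.mul_mem_left _ _ hhN) (Ideal.mul_mem_right _ _ hgM))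
      fun i j ↦ J.mul_mem_right _ hy

lemma conj_mem_layer {K : Subgroup (Matrix.SpecialLinearGroup n R)} [K.Normal] (hy : y * y ∈ J)
    (g : Matrix.SpecialLinearGroup n (ResidueField R)) {B : Matrix n n (ResidueField R)}
    (hB : B ∈ layer K hy) : g.1 * B * (g⁻¹).1 ∈ layer K hy := by
  obtain ⟨h, hh, M, rfl, hM⟩ := hB
  obtain ⟨g, rfl⟩ := specialLinearGroup_map_surjective residue_surjective g
  refine ⟨g * h * g⁻¹, ‹K.Normal›.conj_mem h hh g, g.1 * M * (g⁻¹).1, ?_, ?_⟩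
  · simp [Matrix.map_mul, ← map_inv]
  · have hconj : (g * h * g⁻¹).1 - (1 + y • (g.1 * M * (g⁻¹).1)) =
        g.1 * (h.1 - (1 + y • M)) * (g⁻¹).1 := by
      have hg : g.1 * (g⁻¹).1 = 1 := by rw [← Matrix.SpecialLinearGroup.coe_mul, mul_inv_cancel,
        Matrix.SpecialLinearGroup.coe_one]
      rw [mul_sub, sub_mul, mul_add, add_mul, mul_one, hg, mul_smul_comm, smul_mul_assoc,
        Matrix.SpecialLinearGroup.coe_mul, Matrix.SpecialLinearGroup.coe_mul]
    rw [hconj]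
    exact Ideal.mul_mem_right _ _ (Ideal.mul_mem_left _ _ hM)

end Layer

section Step

open IsLocalRing

variable {R : Type*} [CommRing R] {I J : Ideal R}

lemma mul_trace_mem_of_sub_mem_matrix {y : R} (hy : y * y ∈ J) {h : SL(2, R)}
    {M : Matrix (Fin 2) (Fin 2) R} (hM : h.1 - (1 + y • M) ∈ J.matrix (Fin 2)) :
    y * M.trace ∈ J := by
  have hdet : h 0 0 * h 1 1 - h 0 1 * h 1 0 = 1 := by rw [← Matrix.det_fin_two, h.2]
  have hentry (i j) : Ideal.Quotient.mk J (h i j) =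
      Ideal.Quotient.mk J ((1 : Matrix (Fin 2) (Fin 2) R) i j + y * M i j) :=
    Ideal.Quotient.eq.2 (hM i j)
  have hyy : Ideal.Quotient.mk J y * Ideal.Quotient.mk J y = 0 := by
    rwa [← map_mul, Ideal.Quotient.eq_zero_iff_mem]
  have hdet' := congrArg (Ideal.Quotient.mk J) hdet
  simp only [map_sub, map_mul, hentry, Matrix.one_apply_eq, map_add, map_one, ne_eq, zero_ne_one,
    not_false_eq_true, Matrix.one_apply_ne, zero_add, one_ne_zero] at hdet'
  rw [← Ideal.Quotient.eq_zero_iff_mem, Matrix.trace_fin_two, map_mul, map_add]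
  grind

lemma exists_sub_mem_matrix_of_mem_principalCongruence {n : Type*} [Fintype n] [DecidableEq n]
    {y : R} (hI : I ≤ Ideal.span {y} ⊔ J) {g : Matrix.SpecialLinearGroup n R}
    (hg : g ∈ principalCongruence n I) :
    ∃ M : Matrix n n R, g.1 - (1 + y • M) ∈ J.matrix n := by
  have hentry (i j) : ∃ m, (g.1 - 1) i j - y * m ∈ J := by
    obtain ⟨_, hm, c, hc, h⟩ := Submodule.mem_sup.1 (hI (mem_principalCongruence.1 hg i j))
    obtain ⟨m, rfl⟩ := Ideal.mem_span_singleton'.1 hm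
    exact ⟨m, by rwa [← h, mul_comm y, add_sub_cancel_left]⟩
  choose M hM using hentry
  exact ⟨Matrix.of M, sub_sub g.1 1 (y • Matrix.of M) ▸ hM⟩

lemma principalCongruence_le_of_exists [IsLocalRing R] [CharP (ResidueField R) 2]
    [PerfectRing (ResidueField R) 2] (hk : Nat.card (ResidueField R) ≠ 2)
    {y : R} (hy : y ∈ maximalIdeal R) (hyJ : ∀ a ∈ maximalIdeal R, a * y ∈ J) (hyJ' : y ∉ J)
    (hI : I ≤ Ideal.span {y} ⊔ J) {G : Subgroup SL(2, R)}
    [(G ⊓ principalCongruence (Fin 2) I).Normal] (hJG : principalCongruence (Fin 2) J ≤ G)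
    {h : SL(2, R)} (hG : h ∈ G) (hhI : h ∈ principalCongruence (Fin 2) I)
    (hne : h 0 1 ∉ J ∨ h 1 0 ∉ J) : principalCongruence (Fin 2) I ≤ G := by
  have htrace {g : SL(2, R)} {M : Matrix (Fin 2) (Fin 2) R}
      (hM : g.1 - (1 + y • M) ∈ J.matrix (Fin 2)) : (M.map (residue R)).trace = 0 := by
    rw [← AddMonoidHom.map_trace, residue_eq_zero_iff]
    by_contra hunit
    exact hyJ' ((J.mul_unit_mem_iff_mem (notMem_maximalIdeal.1 hunit)).1
      (mul_trace_mem_of_sub_mem_matrix (hyJ y hy) hM))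
  obtain ⟨M, hM⟩ := exists_sub_mem_matrix_of_mem_principalCongruence hI hhI
  have hoff {i j} (hij : i ≠ j) (hh : h i j ∉ J) : M.map (residue R) i j ≠ 0 := by
    refine fun h0 ↦ hh ?_
    have hyM := hyJ _ ((residue_eq_zero_iff _).1 h0)
    simpa [hij, mul_comm y] using add_mem (hM i j) hyM
  intro g hg
  obtain ⟨N, hN⟩ := exists_sub_mem_matrix_of_mem_principalCongruence hI hg
  obtain ⟨a, ha, N', hNN', hN'⟩ : N.map (residue R) ∈
      layer (G ⊓ principalCongruence (Fin 2) I) (hyJ y hy) :=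
    mem_of_trace_eq_zero hk (fun g _ ↦ conj_mem_layer _ g) ⟨h, ⟨hG, hhI⟩, M, rfl, hM⟩ (htrace hM)
      (hne.imp (hoff (by decide)) (hoff (by decide))) (htrace hN)
  have hag : a⁻¹ * g ∈ principalCongruence (Fin 2) J := by
    have hdiff : y • (N - N') ∈ J.matrix (Fin 2) := fun i j ↦ by
      rw [Matrix.smul_apply, smul_eq_mul, mul_comm]
      refine hyJ _ ?_
      rw [← residue_eq_zero_iff, Matrix.sub_apply, map_sub, sub_eq_zero]
      exact (congrFun (congrFun hNN' i) j).symm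
    have hga : g.1 - a.1 = (g.1 - (1 + y • N)) - (a.1 - (1 + y • N')) + y • (N - N') := by
      rw [smul_sub]
      abel
    rw [inv_mul_mem_principalCongruence, hga]
    exact add_mem (sub_mem hN hN') hdiff
  exact (G.mul_mem_cancel_left (G.inv_mem ha.1)).1 (hJG hag)

lemma pow_le_span_sup_pow_succ {x : R} (hx : x ∈ I) (hI : I ≤ Ideal.span {x} ⊔ I ^ 2) (n : ℕ) :
    I ^ n ≤ Ideal.span {x ^ n} ⊔ I ^ (n + 1) := by
  induction n with
  | zero => simp
  | succ n ih =>
    have hxI : Ideal.span {x} ⊔ I ^ 2 ≤ I :=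
      sup_le ((Ideal.span_singleton_le_iff_mem _).2 hx) (Ideal.pow_le_self two_ne_zero)
    have hxn : Ideal.span {x ^ n} ≤ I ^ n :=
      (Ideal.span_singleton_le_iff_mem _).2 (Ideal.pow_mem_pow hx n)
    calc I ^ (n + 1) ≤ (Ideal.span {x ^ n} ⊔ I ^ (n + 1)) * (Ideal.span {x} ⊔ I ^ 2) := by
          rw [pow_succ]
          exact Ideal.mul_mono ih hI
      _ ≤ Ideal.span {x ^ (n + 1)} ⊔ I ^ (n + 1 + 1) := by
          rw [Ideal.sup_mul, Ideal.mul_sup, Ideal.span_singleton_mul_span_singleton, ← pow_succ,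
            sup_assoc]
          refine sup_le_sup_left (sup_le ?_ (Ideal.mul_mono_right hxI)) _
          exact (Ideal.mul_mono_left hxn).trans (pow_add I n 2).ge

lemma sup_principalCongruence_pow_succ_eq_top [IsLocalRing R] [CharP (ResidueField R) 2]
    [PerfectRing (ResidueField R) 2] (hk : Nat.card (ResidueField R) ≠ 2)
    {x : R} (hx : x ∈ maximalIdeal R) (hspan : maximalIdeal R ≤ Ideal.span {x} ⊔ maximalIdeal R ^ 2)
    {n : ℕ} (hn : n ≠ 0) {H : Subgroup SL(2, R)}
    (hH : H ⊔ principalCongruence (Fin 2) (maximalIdeal R ^ n) = ⊤)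
    (hex : x ^ n ∉ maximalIdeal R ^ (n + 1) →
      ∃ h ∈ H ⊔ principalCongruence (Fin 2) (maximalIdeal R ^ (n + 1)),
        h ∈ principalCongruence (Fin 2) (maximalIdeal R ^ n) ∧
          (h 0 1 ∉ maximalIdeal R ^ (n + 1) ∨ h 1 0 ∉ maximalIdeal R ^ (n + 1))) :
    H ⊔ principalCongruence (Fin 2) (maximalIdeal R ^ (n + 1)) = ⊤ := by
  set G := H ⊔ principalCongruence (Fin 2) (maximalIdeal R ^ (n + 1))
  have hpow := pow_le_span_sup_pow_succ hx hspan n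
  suffices principalCongruence (Fin 2) (maximalIdeal R ^ n) ≤ G from
    top_unique (hH.ge.trans (sup_le le_sup_left this))
  by_cases hxn : x ^ n ∈ maximalIdeal R ^ (n + 1)
  · rw [sup_eq_right.2 ((Ideal.span_singleton_le_iff_mem _).2 hxn)] at hpow
    exact (principalCongruence_mono hpow).trans le_sup_right
  obtain ⟨h, hG, hhn, hne⟩ := hex hxn
  have hG1 : G ⊔ principalCongruence (Fin 2) (maximalIdeal R) = ⊤ :=
    top_unique (hH.ge.trans
      (sup_le_sup le_sup_left (principalCongruence_mono (Ideal.pow_le_self hn))))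
  have : (G ⊓ principalCongruence (Fin 2) (maximalIdeal R ^ n)).Normal :=
    normal_inf_of_sup_eq_top hG1
      ((Subgroup.commutator_comm _ _).trans_le
        ((commutator_principalCongruence_pow_le n).trans le_sup_right))
  refine principalCongruence_le_of_exists hk (Ideal.pow_le_self hn (Ideal.pow_mem_pow hx n))
    (fun a ha ↦ ?_) hxn hpow le_sup_right hG hhn hne
  exact pow_succ' (maximalIdeal R) n ▸ Ideal.mul_mem_mul ha (Ideal.pow_mem_pow hx n)

end Step

section Nonscalar

variable {R : Type*} [CommRing R] {I : Ideal R} {H : Subgroup SL(2, R)} {x t : R} {n : ℕ}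

lemma upper_mul_pow_mem_sup (hx : x ∈ I) (hu : IsUnit (1 + x)) (hn : n ≠ 0)
    (h : H ⊔ principalCongruence (Fin 2) (I ^ (n + 2)) = ⊤) :
    upper (((1 + x) ^ 2 - 1) * x ^ n) ∈ H ⊔ principalCongruence (Fin 2) (I ^ (n + 2 + 1)) := by
  obtain ⟨u, hu⟩ := hu
  have hcomm := commutator_self_le_of_sup_eq_top
    (H := H ⊔ principalCongruence (Fin 2) (I ^ (n + 2 + 1)))
    (principalCongruence_mono (Ideal.pow_le_self (n + 1).succ_ne_zero))
    (top_unique (h.ge.trans (sup_le_sup_right le_sup_left _)))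
    ((commutator_principalCongruence_pow_le _).trans le_sup_right)
  rw [← hu, ← commutator_torus_upper]
  exact hcomm (Subgroup.commutator_mem_commutator
    (torus_mem_principalCongruence (by simpa [hu] using hx))
    (upper_mem_principalCongruence (Ideal.pow_mem_of_mem I hx n hn.bot_lt)))

lemma sq_sub_one_mul_pow_sub_mem (hx : x ∈ I) (h2 : 2 ∈ I ^ 2) (n : ℕ) :
    ((1 + x) ^ 2 - 1) * x ^ n - x ^ (n + 2) ∈ I ^ (n + 2 + 1) := by
  have h2x : 2 * x ^ (n + 1) ∈ I ^ (2 + (n + 1)) :=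
    pow_add I 2 (n + 1) ▸ Ideal.mul_mem_mul h2 (Ideal.pow_mem_pow hx (n + 1))
  rw [add_left_comm, add_comm 2, ← add_assoc] at h2x
  convert h2x using 1
  ring

lemma upper_two_mul_mem_sup (h2 : 2 ∈ I) (hn : n ≠ 0) (ht : t ∈ I)
    (h : H ⊔ principalCongruence (Fin 2) (I ^ n) = ⊤) :
    upper (2 * t) ∈ H ⊔ principalCongruence (Fin 2) (I ^ (n + 1)) := by
  rw [← upper_pow_two]
  refine sq_mem_of_sup_eq_top (principalCongruence_mono (Ideal.pow_le_self hn))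
    (top_unique (h.ge.trans (sup_le_sup_right le_sup_left _)))
    ((commutator_principalCongruence_pow_le n).trans le_sup_right) (fun c hc ↦ ?_)
    (upper_mem_principalCongruence ht)
  exact le_sup_right (a := H)
    (pow_succ' I n ▸ sq_mem_principalCongruence h2 (Ideal.pow_le_self hn) hc)

lemma commutator_torus_apply_one_zero (u : Rˣ) (h : SL(2, R)) :
    ⁅torus u, h⁆.1 1 0 = (((u⁻¹ : Rˣ) : R) ^ 2 - 1) * (h 1 0 * h 1 1) := by
  simp only [commutatorElement_def, Matrix.SpecialLinearGroup.coe_mul, coe_inv_fin_two, coe_torus,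
    Matrix.mul_apply, Fin.sum_univ_two, Matrix.of_apply, Matrix.cons_val', Matrix.cons_val_zero,
    Matrix.cons_val_one, Matrix.cons_val_fin_one, zero_mul,
    mul_zero, zero_add, add_zero, neg_zero, mul_neg]
  linear_combination (-h 1 0 * h 1 1) * u.inv_mul

lemma commutator_upper_one_apply_zero_one (h : SL(2, R)) :
    ⁅(upper 1 : SL(2, R)), h⁆.1 0 1 = (h 1 1 - h 0 0 - h 1 0) * h 0 0 - h 0 1 * h 1 0 := by
  simp only [commutatorElement_def, Matrix.SpecialLinearGroup.coe_mul, coe_inv_fin_two, coe_upper,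
    Matrix.mul_apply, Fin.sum_univ_two, Matrix.of_apply, Matrix.cons_val', Matrix.cons_val_zero,
    Matrix.cons_val_one, Matrix.cons_val_fin_one, one_mul,
    mul_one, mul_zero, add_zero, neg_zero, mul_neg, neg_add_rev]
  ring

lemma mul_apply_one_zero_add_two_mem_sq (h2 : 2 ∈ I) (ht : IsUnit t) {h : SL(2, R)}
    (hh : h.1 - (upper t).1 ∈ I.matrix (Fin 2))
    (hsq : (h ^ 2) 0 1 ∈ I ^ 2) : t * h 1 0 + 2 ∈ I ^ 2 := by
  have hdet : h 0 0 * h 1 1 - h 0 1 * h 1 0 = 1 := by rw [← Matrix.det_fin_two, h.2]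
  have h00 : h 0 0 - 1 ∈ I := hh 0 0
  have h01 : h 0 1 - t ∈ I := hh 0 1
  have h10 : h 1 0 ∈ I := by simpa [coe_upper] using hh 1 0
  have h11 : h 1 1 - 1 ∈ I := hh 1 1
  have hsq' : h 0 1 * (h 0 0 + h 1 1) ∈ I ^ 2 := by
    have : (h ^ 2) 0 1 = h 0 1 * (h 0 0 + h 1 1) := by
      rw [sq, Matrix.SpecialLinearGroup.coe_mul, Matrix.mul_apply, Fin.sum_univ_two]
      ring
    rwa [← this]
  have htr : h 0 0 + h 1 1 ∈ I := by
    convert add_mem (add_mem h00 h11) h2 using 1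
    ring
  have htr' : h 0 0 + h 1 1 ∈ I ^ 2 := by
    refine (Ideal.unit_mul_mem_iff_mem _ ht).1 ?_
    convert sub_mem hsq' (sq I ▸ Ideal.mul_mem_mul h01 htr) using 1
    ring
  have hrest : (h 0 0 - 1) * (h 1 1 - 1) - (h 0 1 - t) * h 1 0 ∈ I ^ 2 :=
    sq I ▸ sub_mem (Ideal.mul_mem_mul h00 h11) (Ideal.mul_mem_mul h01 h10)
  convert add_mem htr' hrest using 1
  linear_combination -hdet

lemma apply_one_zero_sub_sub_mem_sq {s : R} {g h r : SL(2, R)}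
    (hg : g.1 - (upper s).1 ∈ I.matrix (Fin 2)) (hh : h.1 - (upper t).1 ∈ I.matrix (Fin 2))
    (hr : r.1 - (upper (s + t)).1 ∈ I.matrix (Fin 2))
    (hmul : (g * h * r⁻¹) 1 0 ∈ I ^ 2) : r 1 0 - g 1 0 - h 1 0 ∈ I ^ 2 := by
  have hmul_apply : (g * h * r⁻¹) 1 0 =
      (g 1 0 * h 0 0 + g 1 1 * h 1 0) * r 1 1 - (g 1 0 * h 0 1 + g 1 1 * h 1 1) * r 1 0 := by
    simp only [Matrix.SpecialLinearGroup.coe_mul, coe_inv_fin_two, Matrix.mul_apply,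
      Fin.sum_univ_two, Matrix.of_apply, Matrix.cons_val', Matrix.cons_val_zero,
      Matrix.cons_val_one, Matrix.cons_val_fin_one, mul_neg]
    ring
  have hg0 : g 1 0 ∈ I := by simpa [coe_upper] using hg 1 0
  have hh0 : h 1 0 ∈ I := by simpa [coe_upper] using hh 1 0
  have hr0 : r 1 0 ∈ I := by simpa [coe_upper] using hr 1 0
  have hg1 : g 1 1 - 1 ∈ I := hg 1 1
  have hh1 : h 1 1 - 1 ∈ I := hh 1 1
  have hr1 : r 1 1 - 1 ∈ I := hr 1 1
  have hh00 : h 0 0 - 1 ∈ I := hh 0 0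
  have hA : g 1 0 * (h 0 0 * (r 1 1 - 1) + (h 0 0 - 1) - h 0 1 * r 1 0) ∈ I ^ 2 :=
    sq I ▸ Ideal.mul_mem_mul hg0
      (sub_mem (add_mem (I.mul_mem_left _ hr1) hh00) (I.mul_mem_left _ hr0))
  have hB : h 1 0 * (g 1 1 * (r 1 1 - 1) + (g 1 1 - 1)) ∈ I ^ 2 :=
    sq I ▸ Ideal.mul_mem_mul hh0 (add_mem (I.mul_mem_left _ hr1) hg1)
  have hC : r 1 0 * (g 1 1 * (h 1 1 - 1) + (g 1 1 - 1)) ∈ I ^ 2 :=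
    sq I ▸ Ideal.mul_mem_mul hr0 (add_mem (I.mul_mem_left _ hh1) hg1)
  convert sub_mem (sub_mem (add_mem hA hB) hC) hmul using 1
  rw [hmul_apply]
  ring

lemma exists_apply_notMem_sq (h2 : 2 ∈ I) (h22 : 2 ∉ I ^ 2) {s : R} (hs : IsUnit s)
    (hs1 : IsUnit (s + 1)) (hs2 : IsUnit (s ^ 2 + s + 1))
    (h : H ⊔ principalCongruence (Fin 2) I = ⊤) :
    ∃ k ∈ H, k ∈ principalCongruence (Fin 2) I ∧ (k 0 1 ∉ I ^ 2 ∨ k 1 0 ∉ I ^ 2) := by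
  -- Modulo `I ^ 2`, the lower left entry `c t` of a lift of `upper t` to `H` would be additive in
  -- `t` and satisfy `t * c t = -2` for units `t`; compare `1`, `s` and `s + 1`.
  by_contra! hk
  have hlift (t : R) := exists_mem_sub_mem_matrix h (upper t)
  choose g hgH hg using hlift
  have hcong (t : R) : (g t : SL(2, R) ⧸ principalCongruence (Fin 2) I) = upper t :=
    (QuotientGroup.eq.2 (inv_mul_mem_principalCongruence.2 (hg t))).symm
  have hsq {t : R} (ht : IsUnit t) : t * g t 1 0 + 2 ∈ I ^ 2 := by
    refine mul_apply_one_zero_add_two_mem_sq h2 ht (hg t) (hk _ (H.pow_mem (hgH t) 2) ?_).1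
    rw [← QuotientGroup.eq_one_iff, QuotientGroup.mk_pow, hcong, ← QuotientGroup.mk_pow,
      upper_pow_two, QuotientGroup.eq_one_iff]
    exact upper_mem_principalCongruence (I.mul_mem_right t h2)
  have hadd : g (s + 1) 1 0 - g s 1 0 - g 1 1 0 ∈ I ^ 2 := by
    refine apply_one_zero_sub_sub_mem_sq (hg s) (hg 1) (hg (s + 1))
      (hk _ (H.mul_mem (H.mul_mem (hgH s) (hgH 1)) (H.inv_mem (hgH (s + 1)))) ?_).2
    rw [← QuotientGroup.eq_one_iff, QuotientGroup.mk_mul, QuotientGroup.mk_mul, hcong, hcong,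
      QuotientGroup.mk_inv, hcong, ← QuotientGroup.mk_mul, upper_mul, mul_inv_cancel]
  refine h22 ((Ideal.unit_mul_mem_iff_mem _ hs2).1 ?_)
  convert sub_mem (add_mem (Ideal.mul_mem_left _ (s + 1) (hsq hs))
    (Ideal.mul_mem_left _ (s * (s + 1)) (hsq isUnit_one)))
    (sub_mem (Ideal.mul_mem_left _ s (hsq hs1)) (Ideal.mul_mem_left _ (s * (s + 1)) hadd)) using 1
  ring

lemma sub_smul_one_mem_matrix_of_sub_torus_mem (h2 : 2 ∈ I ^ 2) {u : Rˣ}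
    (hu : (u : R) - 1 ∈ I) {h : SL(2, R)} (hh : h.1 - (torus u).1 ∈ (I ^ 2).matrix (Fin 2)) :
    h.1 - (u : R) • 1 ∈ (I ^ 2).matrix (Fin 2) := by
  have hinv : ((u⁻¹ : Rˣ) : R) - u ∈ I ^ 2 := by
    have hsq : ((u : R) - 1) ^ 2 + 2 * (u - 1) ∈ I ^ 2 :=
      add_mem (Ideal.pow_mem_pow hu 2) (Ideal.mul_mem_right _ _ h2)
    convert Ideal.mul_mem_left _ (-((u⁻¹ : Rˣ) : R)) hsq using 1
    linear_combination (u : R) * u.inv_mul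
  have htorus : (torus u).1 - (u : R) • 1 ∈ (I ^ 2).matrix (Fin 2) := by
    rw [Ideal.mem_matrix]
    simp [Fin.forall_fin_two, coe_torus, hinv]
  simpa using add_mem hh htorus

lemma sq_mem_pow_three_of_sub_mem (hx : x ∈ I) (h2 : 2 ∈ I ^ 2) {h : SL(2, R)}
    (h00 : h 0 0 - (1 + x) ∈ I ^ 2) (h10 : h 1 0 ∈ I ^ 3) (h11 : h 1 1 - h 0 0 ∈ I ^ 3) :
    x ^ 2 ∈ I ^ 3 := by
  have hdet : h 0 0 * h 1 1 - h 0 1 * h 1 0 = 1 := by rw [← Matrix.det_fin_two, h.2]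
  obtain ⟨p, hp⟩ : ∃ p, h 0 0 = 1 + x + p := ⟨_, (add_sub_cancel _ _).symm⟩
  rw [hp, add_sub_cancel_left] at h00
  have hpI : p ∈ I := Ideal.pow_le_self two_ne_zero h00
  have hpp : p * p ∈ I ^ 3 := pow_succ I 2 ▸ Ideal.mul_mem_mul h00 hpI
  have h2x : 2 * (x + p + x * p) ∈ I ^ 3 :=
    pow_succ I 2 ▸ Ideal.mul_mem_mul h2 (add_mem (add_mem hx hpI) (I.mul_mem_left x hpI))
  convert sub_mem (sub_mem (sub_mem (Ideal.mul_mem_left _ (h 0 1) h10)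
    (Ideal.mul_mem_left _ (h 0 0) h11)) hpp) h2x using 1
  rw [hp] at hdet ⊢
  linear_combination hdet

end Nonscalar

section LocalRing

open IsLocalRing

variable {R : Type*} [CommRing R] [IsLocalRing R]

lemma isUnit_of_sub_one_mem_maximalIdeal {a : R} (ha : a - 1 ∈ maximalIdeal R) : IsUnit a := by
  refine isUnit_of_map_unit (residue R) a ?_
  rw [sub_eq_zero.1 ((map_sub (residue R) a 1).symm.trans ((residue_eq_zero_iff _).2 ha)), map_one]
  exact isUnit_one

lemma two_mem_maximalIdeal [CharP (ResidueField R) 2] : (2 : R) ∈ maximalIdeal R := by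
  rw [← residue_eq_zero_iff, map_ofNat, CharTwo.two_eq_zero]

lemma exists_isUnit_sq_sub_one [CharP (ResidueField R) 2] (hk : Nat.card (ResidueField R) ≠ 2) :
    ∃ u : Rˣ, IsUnit ((u : R) ^ 2 - 1) := by
  obtain ⟨s, hs0, hs1⟩ := exists_ne_zero_ne_one hk
  obtain ⟨a, rfl⟩ := residue_surjective s
  obtain ⟨u, rfl⟩ := isUnit_of_map_unit (residue R) a hs0.isUnit
  refine ⟨u, isUnit_of_map_unit (residue R) _ (isUnit_iff_ne_zero.2 ?_)⟩
  rw [map_sub, map_pow, map_one, CharTwo.sub_eq_add, ← one_pow 2, ← CharTwo.add_sq]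
  exact pow_ne_zero 2 fun h ↦ hs1 (CharTwo.add_eq_zero.1 h)

lemma exists_isUnit_sq_add_add_one [CharP (ResidueField R) 2]
    (hk2 : Nat.card (ResidueField R) ≠ 2) (hk4 : Nat.card (ResidueField R) ≠ 4) :
    ∃ s : R, IsUnit s ∧ IsUnit (s + 1) ∧ IsUnit (s ^ 2 + s + 1) := by
  obtain ⟨s, hs0, hs1, hs2⟩ := exists_sq_add_add_one_ne_zero hk2 hk4
  obtain ⟨a, rfl⟩ := residue_surjective s
  refine ⟨a, ?_, ?_, ?_⟩ <;> refine isUnit_of_map_unit (residue R) _ (isUnit_iff_ne_zero.2 ?_)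
  · exact hs0
  · simpa [CharTwo.add_eq_zero] using hs1
  · simpa using hs2

lemma exists_apply_notMem_pow_three [CharP (ResidueField R) 2]
    (hk : Nat.card (ResidueField R) ≠ 2) {x : R} (hx : x ∈ maximalIdeal R)
    (hx2 : x ^ 2 ∉ maximalIdeal R ^ 3) (h2 : 2 ∈ maximalIdeal R ^ 2) {G : Subgroup SL(2, R)}
    (hG : G ⊔ principalCongruence (Fin 2) (maximalIdeal R ^ 2) = ⊤)
    (hle : principalCongruence (Fin 2) (maximalIdeal R ^ 3) ≤ G) :
    ∃ g ∈ G, g ∈ principalCongruence (Fin 2) (maximalIdeal R ^ 2) ∧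
      (g 0 1 ∉ maximalIdeal R ^ 3 ∨ g 1 0 ∉ maximalIdeal R ^ 3) := by
  -- Otherwise the commutators of a lift `h` of `torus (1 + x)` to `G` have off-diagonal entries in
  -- `𝔪 ^ 3`, so that `h` is modulo `𝔪 ^ 3` upper triangular with equal diagonal entries; then
  -- `det h = 1` forces `x ^ 2 ∈ 𝔪 ^ 3`.
  by_contra! hoff
  obtain ⟨u, hu⟩ : IsUnit (1 + x) := isUnit_of_sub_one_mem_maximalIdeal (by simpa)
  have hu1 : (u : R) - 1 ∈ maximalIdeal R := by simpa [hu]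
  obtain ⟨h, hhG, hh⟩ := exists_mem_sub_mem_matrix hG (torus u)
  have hscalar := sub_smul_one_mem_matrix_of_sub_torus_mem h2 hu1 hh
  have hnormal : (G ⊓ principalCongruence (Fin 2) (maximalIdeal R)).Normal :=
    normal_inf_of_sup_eq_top hG ((commutator_principalCongruence_pow_le 2).trans hle)
  have hh1 : h ∈ principalCongruence (Fin 2) (maximalIdeal R) :=
    mem_principalCongruence_of_sub_smul_mem (Ideal.pow_le_self two_ne_zero) hu1 hscalar
  have hunit (i : Fin 2) : IsUnit (h i i) := isUnit_of_sub_one_mem_maximalIdeal (by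
    simpa using mem_principalCongruence.1 hh1 i i)
  have hcomm (g : SL(2, R)) := hoff ⁅g, h⁆
    (G.mul_mem (hnormal.conj_mem h ⟨hhG, hh1⟩ g).1 (G.inv_mem hhG))
    (commutator_mem_principalCongruence_of_sub_smul_mem g hscalar)
  have h10 : h 1 0 ∈ maximalIdeal R ^ 3 := by
    obtain ⟨v, hv⟩ := exists_isUnit_sq_sub_one (R := R) hk
    have := (hcomm (torus v⁻¹)).2
    rw [commutator_torus_apply_one_zero, inv_inv, Ideal.unit_mul_mem_iff_mem _ hv] at this
    exact (Ideal.mul_unit_mem_iff_mem _ (hunit 1)).1 this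
  have h11 : h 1 1 - h 0 0 ∈ maximalIdeal R ^ 3 := by
    have := (hcomm (upper 1)).1
    rw [commutator_upper_one_apply_zero_one] at this
    have := add_mem this (Ideal.mul_mem_left _ (h 0 1) h10)
    rw [sub_add_cancel, Ideal.mul_unit_mem_iff_mem _ (hunit 0)] at this
    simpa using add_mem this h10
  exact hx2 (sq_mem_pow_three_of_sub_mem hx h2 (hu ▸ hh 0 0) h10 h11)

lemma maximalIdeal_le_span_sup_sq
    (hdim : Module.finrank (ResidueField R) (CotangentSpace R) = 1) {x : R}
    (hx : x ∈ maximalIdeal R) (hx2 : x ∉ maximalIdeal R ^ 2) :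
    maximalIdeal R ≤ Ideal.span {x} ⊔ maximalIdeal R ^ 2 := by
  intro y hy
  have hne : (maximalIdeal R).toCotangent ⟨x, hx⟩ ≠ 0 := by
    rwa [Ne, Ideal.toCotangent_eq_zero]
  obtain ⟨c, hc⟩ := (finrank_eq_one_iff_of_nonzero' (K := ResidueField R) (V := CotangentSpace R)
    _ hne).1 hdim ((maximalIdeal R).toCotangent ⟨y, hy⟩)
  obtain ⟨c, rfl⟩ := residue_surjective c
  have hcx : (maximalIdeal R).toCotangent (c • ⟨x, hx⟩) = (maximalIdeal R).toCotangent ⟨y, hy⟩ := by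
    rw [map_smul]
    exact hc
  have hycx : y - c * x ∈ maximalIdeal R ^ 2 := (Ideal.toCotangent_eq _).1 hcx.symm
  exact Submodule.mem_sup.2
    ⟨c * x, Ideal.mul_mem_left _ c (Ideal.mem_span_singleton_self x), _, hycx, add_sub_cancel _ _⟩

lemma exists_mem_maximalIdeal_notMem_sq
    (hdim : Module.finrank (ResidueField R) (CotangentSpace R) = 1) :
    ∃ x ∈ maximalIdeal R, x ∉ maximalIdeal R ^ 2 := by
  have : Nontrivial (CotangentSpace R) := Module.nontrivial_of_finrank_eq_succ hdim
  obtain ⟨v, hv⟩ := exists_ne (0 : CotangentSpace R)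
  obtain ⟨x, rfl⟩ := (maximalIdeal R).toCotangent_surjective v
  exact ⟨x, x.2, fun h ↦ hv ((Ideal.toCotangent_eq_zero _ _).2 h)⟩

lemma exists_maximalIdeal_pow_le (I : Ideal R) [IsArtinianRing (R ⧸ I)] :
    ∃ n, maximalIdeal R ^ n ≤ I := by
  obtain ⟨n, hn⟩ := IsArtinianRing.isNilpotent_jacobson_bot (R := R ⧸ I)
  have hjac : (maximalIdeal R).map (Ideal.Quotient.mk I) ≤ Ideal.jacobson ⊥ := by
    rw [Ideal.map_le_iff_le_comap, Ideal.comap_jacobson_of_surjective Ideal.Quotient.mk_surjective]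
    exact maximalIdeal_le_jacobson _
  refine ⟨n, ?_⟩
  calc maximalIdeal R ^ n ≤ Ideal.comap (Ideal.Quotient.mk I) ⊥ := by
        rw [← Ideal.map_le_iff_le_comap, Ideal.map_pow]
        exact (Ideal.pow_right_mono hjac n).trans hn.le
    _ = I := Ideal.mk_ker

lemma nonempty_ringEquiv_of_surjective_wittVector (p : ℕ) [Fact p.Prime] {F : Type*}
    [Field F] [CharP F p] [PerfectRing F p] {k : Type*} [Field k] {f : WittVector p F →+* k}
    (hf : Function.Surjective f) : Nonempty (F ≃+* k) := by
  have hcoeff : Function.Surjective (WittVector.constantCoeff : WittVector p F →+* F) := fun a ↦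
    ⟨WittVector.teichmuller p a, WittVector.teichmuller_coeff_zero p a⟩
  have hker : RingHom.ker (WittVector.constantCoeff : WittVector p F →+* F) = RingHom.ker f := by
    rw [eq_maximalIdeal (RingHom.ker_isMaximal_of_surjective _ hcoeff),
      eq_maximalIdeal (RingHom.ker_isMaximal_of_surjective _ hf)]
  exact ⟨(RingHom.quotientKerEquivOfSurjective hcoeff).symm.trans
    ((Ideal.quotEquivOfEq hker).trans (RingHom.quotientKerEquivOfSurjective hf))⟩

end LocalRing

section Main

open IsLocalRing

variable {R : Type*} [CommRing R] [IsLocalRing R] [CharP (ResidueField R) 2]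

lemma sup_principalCongruence_pow_eq_top_of_two_mem_sq [PerfectRing (ResidueField R) 2]
    (hk : Nat.card (ResidueField R) ≠ 2)
    (hdim : Module.finrank (ResidueField R) (CotangentSpace R) = 1)
    (h2 : (2 : R) ∈ maximalIdeal R ^ 2) {H : Subgroup SL(2, R)}
    (h : H ⊔ principalCongruence (Fin 2) (maximalIdeal R ^ 2) = ⊤) {n : ℕ} (hn : 2 ≤ n) :
    H ⊔ principalCongruence (Fin 2) (maximalIdeal R ^ n) = ⊤ := by
  obtain ⟨x, hx, hx2⟩ := exists_mem_maximalIdeal_notMem_sq hdim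
  induction n, hn using Nat.le_induction with
  | base => exact h
  | succ n hn ih =>
    refine sup_principalCongruence_pow_succ_eq_top hk hx (maximalIdeal_le_span_sup_sq hdim hx hx2)
      (by lia) ih fun hxn ↦ ?_
    obtain rfl | ⟨m, hm, rfl⟩ : n = 2 ∨ ∃ m, m ≠ 0 ∧ n = m + 2 :=
      hn.eq_or_lt'.imp_right fun h ↦ ⟨n - 2, by lia, by lia⟩
    · exact exists_apply_notMem_pow_three hk hx hxn h2
        (top_unique (ih.ge.trans (sup_le_sup_right le_sup_left _))) le_sup_right
    · have hux : IsUnit (1 + x) := isUnit_of_sub_one_mem_maximalIdeal (by simpa)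
      refine ⟨_, upper_mul_pow_mem_sup hx hux hm ih, upper_mem_principalCongruence ?_, Or.inl ?_⟩
      · exact (Submodule.sub_mem_iff_left _ (Ideal.pow_mem_pow hx (m + 2))).1
          (Ideal.pow_le_pow_right (Nat.le_succ _) (sq_sub_one_mul_pow_sub_mem hx h2 m))
      · exact fun h ↦ hxn
          ((Submodule.sub_mem_iff_right _ h).1 (sq_sub_one_mul_pow_sub_mem hx h2 m))

lemma sup_principalCongruence_pow_eq_top_of_two_notMem_sq [PerfectRing (ResidueField R) 2]
    (hk2 : Nat.card (ResidueField R) ≠ 2) (hk4 : Nat.card (ResidueField R) ≠ 4)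
    (hdim : Module.finrank (ResidueField R) (CotangentSpace R) = 1)
    (h22 : (2 : R) ∉ maximalIdeal R ^ 2) {H : Subgroup SL(2, R)}
    (h : H ⊔ principalCongruence (Fin 2) (maximalIdeal R) = ⊤) {n : ℕ} (hn : 1 ≤ n) :
    H ⊔ principalCongruence (Fin 2) (maximalIdeal R ^ n) = ⊤ := by
  have h2 := two_mem_maximalIdeal (R := R)
  induction n, hn using Nat.le_induction with
  | base => rwa [pow_one]
  | succ n hn ih =>
    refine sup_principalCongruence_pow_succ_eq_top hk2 h2 (maximalIdeal_le_span_sup_sq hdim h2 h22)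
      (by lia) ih fun h2n ↦ ?_
    obtain rfl | ⟨m, hm, rfl⟩ : n = 1 ∨ ∃ m, m ≠ 0 ∧ n = m + 1 :=
      hn.eq_or_lt'.imp_right fun h ↦ ⟨n - 1, by lia, by lia⟩
    · obtain ⟨s, hs, hs1, hs2⟩ := exists_isUnit_sq_add_add_one hk2 hk4
      rw [pow_one]
      exact exists_apply_notMem_sq h2 h22 hs hs1 hs2
        (top_unique (h.ge.trans (sup_le_sup_right le_sup_left _)))
    · rw [pow_succ' (2 : R)] at h2n
      exact ⟨_, upper_two_mul_mem_sup h2 m.succ_ne_zero (Ideal.pow_mem_of_mem _ h2 m hm.bot_lt) ih,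
        upper_mem_principalCongruence (pow_succ' (2 : R) m ▸ Ideal.pow_mem_pow h2 (m + 1)),
        Or.inl h2n⟩

lemma sup_principalCongruence_pow_eq_top [PerfectRing (ResidueField R) 2]
    (hk : Nat.card (ResidueField R) ≠ 2)
    (hdim : Module.finrank (ResidueField R) (CotangentSpace R) = 1)
    (h4 : Nat.card (ResidueField R) = 4 → (2 : R) ∈ maximalIdeal R ^ 2) {H : Subgroup SL(2, R)}
    (h : H ⊔ principalCongruence (Fin 2) (Ideal.span {2} ⊔ maximalIdeal R ^ 2) = ⊤) (n : ℕ) :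
    H ⊔ principalCongruence (Fin 2) (maximalIdeal R ^ n) = ⊤ := by
  refine sup_principalCongruence_eq_top_mono (Ideal.pow_le_pow_right (n.le_add_right 2)) ?_
  by_cases h2 : (2 : R) ∈ maximalIdeal R ^ 2
  · refine sup_principalCongruence_pow_eq_top_of_two_mem_sq hk hdim h2 ?_ (by lia)
    rwa [sup_eq_right.2 ((Ideal.span_singleton_le_iff_mem _).2 h2)] at h
  · refine sup_principalCongruence_pow_eq_top_of_two_notMem_sq hk (mt h4 h2) hdim h2 ?_ (by lia)
    exact sup_principalCongruence_eq_top_mono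
      (sup_le ((Ideal.span_singleton_le_iff_mem _).2 two_mem_maximalIdeal)
        (Ideal.pow_le_self two_ne_zero)) h

end Main

end SL2Lift

theorem proposition5_general {R : Type*} [CommRing R] [IsLocalRing R]
    [CharP (IsLocalRing.ResidueField R) 2] [PerfectRing (IsLocalRing.ResidueField R) 2]
    (hk : Nat.card (IsLocalRing.ResidueField R) ≠ 2)
    [TopologicalSpace R] [IsTopologicalRing R] [IsLinearTopology R R]
    (hpow : ∀ I : Ideal R, IsOpen (I : Set R) → ∃ n, IsLocalRing.maximalIdeal R ^ n ≤ I)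
    (hdim : Module.finrank (IsLocalRing.ResidueField R) (IsLocalRing.CotangentSpace R) = 1)
    (hk4 : Nat.card (IsLocalRing.ResidueField R) = 4 → (2 : R) ∈ IsLocalRing.maximalIdeal R ^ 2)
    {H : Subgroup (Matrix.SpecialLinearGroup (Fin 2) R)}
    (hclosed : IsClosed (H : Set (Matrix.SpecialLinearGroup (Fin 2) R)))
    (hsurj : H.map (Matrix.SpecialLinearGroup.map (n := Fin 2)
      (Ideal.Quotient.mk (Ideal.span {(2 : R)} ⊔ IsLocalRing.maximalIdeal R ^ 2))) = ⊤) :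
    H = ⊤ := by
  refine SL2Lift.eq_top_of_isClosed_of_forall_isOpen hclosed fun I hI ↦ ?_
  obtain ⟨n, hn⟩ := hpow I hI
  refine SL2Lift.sup_principalCongruence_eq_top_mono hn ?_
  exact SL2Lift.sup_principalCongruence_pow_eq_top hk hdim hk4
    (SL2Lift.sup_principalCongruence_eq_top_of_map_eq_top hsurj) n

theorem proposition5 (F : Type*) [Field F] [Finite F] [CharP F 2] (hF : Nat.card F ≠ 2)
    (R : Type*) [CommRing R] [IsLocalRing R] [Algebra (WittVector 2 F) R] [UniformSpace R]
    [IsProArtinLocal 2 F R]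
    (hdim : Module.finrank (IsLocalRing.ResidueField R) (IsLocalRing.CotangentSpace R) = 1)
    (hF4 : Nat.card F = 4 → (2 : R) ∈ IsLocalRing.maximalIdeal R ^ 2)
    (H : Subgroup (Matrix.SpecialLinearGroup (Fin 2) R))
    (hclosed : IsClosed (H : Set (Matrix.SpecialLinearGroup (Fin 2) R)))
    (hsurj : H.map (Matrix.SpecialLinearGroup.map (n := Fin 2)
      (Ideal.Quotient.mk (Ideal.span {(2 : R)} ⊔ IsLocalRing.maximalIdeal R ^ 2))) = ⊤) :
    H = ⊤ := by
  obtain ⟨e⟩ := SL2Lift.nonempty_ringEquiv_of_surjective_wittVector 2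
    (IsProArtinLocal.residue_surjective (p := 2) (F := F) (R := R))
  have hcard := Nat.card_congr e.toEquiv
  have : Finite (IsLocalRing.ResidueField R) := Finite.of_equiv _ e.toEquiv
  have : CharP (IsLocalRing.ResidueField R) 2 :=
    charP_of_injective_ringHom (f := (e : F →+* _)) e.injective 2
  have := IsProArtinLocal.isTopologicalRing 2 F (R := R)
  have := IsProArtinLocal.isLinearTopology 2 F (R := R)
  have hpow (I : Ideal R) (hI : IsOpen (I : Set R)) :=
    have := IsProArtinLocal.isArtinianRing_quotient 2 F I hI
    SL2Lift.exists_maximalIdeal_pow_le I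
  exact proposition5_general (hcard ▸ hF) hpow hdim (hcard ▸ hF4) hclosed hsurj
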